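/- Let $R$ be a commutative ring and let $A$ be an associative unital $R$-algebra which is (left) noetherian and such that every finitely generated (left) $A$-module has finite projective dimension (no uniform bound is assumed). Let $\mathbf{D}(A)$ be the derived category of (left) $A$-modules, and let $\mathbf{D}^{\mathrm{perf}}(A)\subseteq\mathbf{D}(A)$ be the triangulated subcategory of perfect complexes, that is, the smallest full triangulated subcategory which contains $A$ and is closed under isomorphisms and direct summands. Let $M:\mathbf{D}^{\mathrm{perf}}(A)^{\mathrm{op}}\to\mathrm{Mod}\text{-}R$ be an $R$-linear cohomological functor, i.e. $M$ sends distinguished triangles to exact sequences of $R$-modules. Put $M^*(A)=\bigoplus_{n\in\mathbb{Z}}M(A[-n])$, regarded as an $A$-module by letting $a\in A$ act on $M(A[-n])$ as $M(\rho_a[-n])$, where $\rho_a:A\to A$, $x\mapsto xa$. If $M^*(A)$ is a finitely generated $A$-module, then $M$ is representable: there are $X\in\mathbf{D}^{\mathrm{perf}}(A)$ and a natural isomorphism $M\cong\mathrm{Hom}_{\mathbf{D}^{\mathrm{perf}}(A)}(-,X)$ of functors $\mathbf{D}^{\mathrm{perf}}(A)^{\mathrm{op}}\to\mathrm{Mod}\text{-}R$.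 -/

import Mathlib

open CategoryTheory CategoryTheory.Limits Opposite
open scoped ModuleCat.Algebra CategoryTheory.Pretriangulated.Opposite DirectSum

universe w v u

namespace PerfRep

/-- Regularity of a ring: every finitely generated (left) module has finite projective
dimension. No uniform bound on these dimensions is required. -/
def IsRegularAlgebra (A : Type u) [Ring A] : Prop :=
  ∀ N : ModuleCat.{u} A, Module.Finite A N → ∃ n : ℕ, HasProjectiveDimensionLE N n

section Perf

variable (A : Type u) [Ring A] [HasDerivedCategory.{w} (ModuleCat.{u} A)]

/-- The module `A`, seen as a complex concentrated in degree `0`, in the derived category of the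
category of (left) `A`-modules. -/
noncomputable def regularObj : DerivedCategory (ModuleCat.{u} A) :=
  (DerivedCategory.singleFunctor (ModuleCat.{u} A) 0).obj (ModuleCat.of A A)

/-- The perfect complexes: all the objects of the derived category which are obtained from `A`
by finitely many shifts, finite direct sums, extensions and direct summands, that is, the
smallest triangulated subcategory closed under direct summands (and isomorphisms)
which contains `A`. -/
def isPerfect : ObjectProperty (DerivedCategory (ModuleCat.{u} A)) :=
  (ObjectProperty.singleton (regularObj A)).triangEnvelope

instance : (isPerfect A).IsTriangulated := by
  unfold isPerfect; infer_instance

instance : (isPerfect A).IsStableUnderRetracts := by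
  unfold isPerfect; infer_instance

/-- The derived category of perfect complexes, with the triangulated structure and the shift
which are induced from the derived category. -/
abbrev Perf := (isPerfect A).FullSubcategory

/-- The object `A` of the derived category of perfect complexes. -/
noncomputable def regularPerf : Perf A :=
  ⟨regularObj A, ObjectProperty.le_triangEnvelope _ _ (by simp)⟩

variable {A}

/-- Right multiplication `x ↦ x * a`, as an endomorphism of the left module `A`, seen as an
endomorphism of `A` in the derived category of perfect complexes. -/
noncomputable def rmul (a : A) : regularPerf A ⟶ regularPerf A :=
  ObjectProperty.homMk ((DerivedCategory.singleFunctor (ModuleCat.{u} A) 0).map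
    (ModuleCat.ofHom (LinearMap.toSpanSingleton A A a)))

lemma rmul_one : rmul (1 : A) = 𝟙 (regularPerf A) := by
  have h : ModuleCat.ofHom (LinearMap.toSpanSingleton A A (1 : A)) = 𝟙 (ModuleCat.of A A) := by
    ext; simp
  exact ObjectProperty.hom_ext _ ((congrArg (DerivedCategory.singleFunctor _ 0).map h).trans
    ((DerivedCategory.singleFunctor _ 0).map_id _))

lemma rmul_mul (a b : A) : rmul (a * b) = rmul a ≫ rmul b := by
  have h : ModuleCat.ofHom (LinearMap.toSpanSingleton A A (a * b)) =
      ModuleCat.ofHom (LinearMap.toSpanSingleton A A a) ≫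
        ModuleCat.ofHom (LinearMap.toSpanSingleton A A b) := by
    ext; simp
  exact ObjectProperty.hom_ext _ ((congrArg (DerivedCategory.singleFunctor _ 0).map h).trans
    ((DerivedCategory.singleFunctor _ 0).map_comp _ _))

lemma rmul_add (a b : A) : rmul (a + b) = rmul a + rmul b := by
  have h : ModuleCat.ofHom (LinearMap.toSpanSingleton A A (a + b)) =
      ModuleCat.ofHom (LinearMap.toSpanSingleton A A a) +
        ModuleCat.ofHom (LinearMap.toSpanSingleton A A b) := by
    ext; simp
  exact ObjectProperty.hom_ext _ ((congrArg (DerivedCategory.singleFunctor _ 0).map h).trans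
    (DerivedCategory.singleFunctor _ 0).map_add)

end Perf

section Values

variable {R : Type v} [CommRing R] {A : Type u} [Ring A]
  [HasDerivedCategory.{w} (ModuleCat.{u} A)]

/-- The degree `n` part `M(A[-n])` of `M^*(A)`. -/
def gradedPart (M : (Perf A)ᵒᵖ ⥤ ModuleCat.{w} R) (n : ℤ) : Type w :=
  M.obj (op ((shiftFunctor (Perf A) (-n)).obj (regularPerf A)))

variable (M : (Perf A)ᵒᵖ ⥤ ModuleCat.{w} R)

noncomputable instance (n : ℤ) : AddCommGroup (gradedPart M n) :=
  inferInstanceAs (AddCommGroup (M.obj (op ((shiftFunctor (Perf A) (-n)).obj (regularPerf A)))))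

/-- The action of `A` on `M(A[-n])`: an element `a` acts by `M(f[-n])`, where `f : A ⟶ A`
is the right multiplication by `a`. -/
noncomputable def gradedAction [M.Additive] (n : ℤ) : A →+* AddMonoid.End (gradedPart M n) :=
  let φ (a : A) := M.map ((shiftFunctor (Perf A) (-n)).map (rmul a)).op
  have h_one : φ 1 = 𝟙 _ := by
    simp only [φ, rmul_one, CategoryTheory.Functor.map_id, op_id]
  have h_mul (a b : A) : φ (a * b) = φ b ≫ φ a := by
    simp only [φ, rmul_mul, Functor.map_comp, op_comp]
  have h_add (a b : A) : φ (a + b) = φ a + φ b := by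
    simp only [φ, rmul_add, Functor.map_add, op_add]
  have h_zero : φ 0 = 0 := by
    have := h_add 0 0
    rwa [add_zero, left_eq_add] at this
  { toFun := fun a => (φ a).hom.toAddMonoidHom
    map_one' := AddMonoidHom.ext fun x => congrArg (fun f => f.hom x) h_one
    map_mul' := fun a b => AddMonoidHom.ext fun x => congrArg (fun f => f.hom x) (h_mul a b)
    map_zero' := AddMonoidHom.ext fun x => congrArg (fun f => f.hom x) h_zero
    map_add' := fun a b => AddMonoidHom.ext fun x => congrArg (fun f => f.hom x) (h_add a b) }

noncomputable instance [M.Additive] (n : ℤ) : Module A (gradedPart M n) :=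
  Module.compHom _ (gradedAction M n)

/-- `M^*(A)`, the direct sum of all the `M(A[-n])`, as an `A`-module. -/
abbrev gradedValue := ⨁ n : ℤ, gradedPart M n

end Values

end PerfRep

/-!
The functor `M` is represented by an explicit approximation procedure which only uses the values
of cohomological functors on the shifts of finitely generated modules, so that neither truncations
nor cohomology modules of complexes are needed. By the Yoneda lemma, a natural transformation
`Hom(-, X) ⟶ M` is an element `x ∈ M(X)`; by the five lemma it is an isomorphism as soon as it is
bijective on all the `A[-n]` (`bijective_yonedaEval_of_regularPerf`).

Since `M^*(A)` is finitely generated, `M(A[-n])` vanishes for `|n|` large, and it is a finitely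
generated `A`-module for all `n`. As in the construction of a free resolution, descending induction
on `m` gives a perfect complex `X` and `x ∈ M(X)` such that `Hom(A[-n], X) → M(A[-n])` is bijective
for `n > m` and surjective for `n = m`, while `Hom(A[-n], X) = 0` for `n < m` (`IsApprox`,
`IsApprox.exists_pred`): one takes the cone of a morphism `A^r[-m] ⟶ X` which covers the kernel in
degree `m`, to which `x` extends as `M` is cohomological, and then adds a free summand in degree
`m - 1`. This uses that `A` is noetherian, but not its regularity.

The procedure is stopped at some `m` such that `M(A[-n]) = 0` for all `n ≤ m`. Then the only
discrepancy between `X` and `M` is the module `N = Hom(A[-m], X)`. Regularity makes it possible to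
remove it: finitely generated modules are perfect (`isPerfect_of_finite`), and a finite resolution
of a module by finitely generated projective modules shows that cohomological functors which
vanish on `A[-n]` for `n < a` also vanish on the `N[-n]` for `n < a` (`stalk_eq_zero`).
Applied to `Hom(-, X)`, this gives a morphism `N[-m] ⟶ X` which is bijective on `Hom(A[-m], -)`
(`exists_stalk_bijective`); applied to `M`, it shows that `x` vanishes on `N[-m]`, and hence
extends to the cone of `N[-m] ⟶ X`, which represents `M`.
-/

namespace PerfRep

/-! ### Homological presheaves on a pretriangulated category -/

section Presheaf

variable {R : Type v} [Ring R] {T : Type*} [Category* T]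

/-- The restriction `F(Y) → F(X)` along a morphism `f : X ⟶ Y`, for a presheaf `F`. -/
def pull (F : Tᵒᵖ ⥤ ModuleCat.{w} R) {X Y : T} (f : X ⟶ Y) :
    F.obj (op Y) →ₗ[R] F.obj (op X) :=
  (F.map f.op).hom

variable (F : Tᵒᵖ ⥤ ModuleCat.{w} R)

@[simp]
lemma pull_id {X : T} (x : F.obj (op X)) : pull F (𝟙 X) x = x := by
  simp [pull]

lemma pull_comp {X Y Z : T} (f : X ⟶ Y) (g : Y ⟶ Z) (x : F.obj (op Z)) :
    pull F (f ≫ g) x = pull F f (pull F g x) := by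
  simp [pull]

lemma pull_injective_of_iso {X Y : T} (e : X ≅ Y) : Function.Injective (pull F e.hom) := by
  intro x y h
  have := congrArg (pull F e.inv) h
  simpa only [← pull_comp, e.inv_hom_id, pull_id] using this

lemma eq_zero_of_iso {X Y : T} (e : X ≅ Y) (h : ∀ x : F.obj (op X), x = 0)
    (y : F.obj (op Y)) : y = 0 :=
  pull_injective_of_iso F e ((h _).trans (map_zero _).symm)

variable [Preadditive T]

lemma pull_add [F.Additive] {X Y : T} (f g : X ⟶ Y) (x : F.obj (op Y)) :
    pull F (f + g) x = pull F f x + pull F g x := by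
  simp [pull]

lemma pull_zero [F.PreservesZeroMorphisms] {X Y : T} (x : F.obj (op Y)) :
    pull F (0 : X ⟶ Y) x = 0 := by
  simp [pull]

/-- The map `Hom(Z, Y) → F(Z)`, `f ↦ F(f)(y)` which corresponds to an element `y ∈ F(Y)` by the
Yoneda lemma. -/
def yonedaEval [F.Additive] {Y : T} (y : F.obj (op Y)) (Z : T) : (Z ⟶ Y) →+ F.obj (op Z) :=
  AddMonoidHom.mk' (fun f => pull F f y) (fun f g => pull_add F f g y)

@[simp]
lemma yonedaEval_apply [F.Additive] {Y Z : T} (y : F.obj (op Y)) (f : Z ⟶ Y) :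
    yonedaEval F y Z f = pull F f y := rfl

variable {F} in
lemma bijective_yonedaEval_of_iso [F.Additive] {Y : T} {y : F.obj (op Y)} {Z Z' : T} (e : Z ≅ Z')
    (h : Function.Bijective (yonedaEval F y Z)) : Function.Bijective (yonedaEval F y Z') := by
  refine ⟨fun f g hfg => ?_, fun t => ?_⟩
  · rw [← cancel_epi e.hom]
    apply h.1
    simp only [yonedaEval_apply, pull_comp] at hfg ⊢
    rw [hfg]
  · obtain ⟨f, hf⟩ := h.2 (pull F e.hom t)
    refine ⟨e.inv ≫ f, pull_injective_of_iso F e ?_⟩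
    rw [yonedaEval_apply, ← pull_comp, e.hom_inv_id_assoc]
    exact hf

variable {F} in
lemma bijective_yonedaEval_of_retract [F.Additive] {Y : T} {y : F.obj (op Y)} {Z Z' : T}
    (r : Retract Z Z')
    (h : Function.Bijective (yonedaEval F y Z')) : Function.Bijective (yonedaEval F y Z) := by
  refine ⟨fun f g hfg => ?_, fun t => ?_⟩
  · have : r.r ≫ f = r.r ≫ g := by
      apply h.1
      simp only [yonedaEval_apply, pull_comp] at hfg ⊢
      rw [hfg]
    simpa using r.i ≫= this
  · obtain ⟨f, hf⟩ := h.2 (pull F r.r t)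
    refine ⟨r.i ≫ f, ?_⟩
    rw [yonedaEval_apply] at hf
    rw [yonedaEval_apply, pull_comp, hf, ← pull_comp, r.retract, pull_id]

end Presheaf

/-- The element `y ∈ F(Y)` gives an isomorphism of functors as soon as it gives bijections
`Hom(Z, Y) → F(Z)` for all `Z`. -/
lemma nonempty_iso_linearYoneda {R : Type v} [CommRing R] {T : Type*} [Category.{w} T]
    [Preadditive T] [Linear R T] (F : Tᵒᵖ ⥤ ModuleCat.{w} R) [F.Additive]
    (hlin : ∀ {X Y : T} (f : X ⟶ Y) (r : R), F.map (r • f).op = r • F.map f.op)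
    {Y : T} (y : F.obj (op Y)) (h : ∀ Z, Function.Bijective (yonedaEval F y Z)) :
    Nonempty (F ≅ (linearYoneda R T).obj Y) := by
  let e (Z : Tᵒᵖ) : (Z.unop ⟶ Y) ≃ₗ[R] F.obj Z :=
    LinearEquiv.ofBijective
      { toFun := yonedaEval F y Z.unop
        map_add' := map_add _
        map_smul' := fun r f => by
          change (F.map (r • f).op).hom y = r • (F.map f.op).hom y
          rw [hlin]
          rfl }
      (h Z.unop)
  refine ⟨(NatIso.ofComponents (fun Z => (e Z).toModuleIso) fun {Z Z'} g => ?_ :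
    (linearYoneda R T).obj Y ≅ F).symm⟩
  ext f
  exact pull_comp F g.unop f y

section Homological

variable {R : Type v} [Ring R] {T : Type*} [Category* T] [Preadditive T] [HasZeroObject T]
  [HasShift T ℤ] [∀ n : ℤ, (shiftFunctor T n).Additive] [Pretriangulated T]

open Pretriangulated

variable (F : Tᵒᵖ ⥤ ModuleCat.{w} R) [F.IsHomological]

/-- Exactness of `F(Z) → F(Y) → F(X)` for a distinguished triangle `X ⟶ Y ⟶ Z ⟶ X[1]`. -/
lemma exists_pull_mor₂_eq (D : Triangle T) (hD : D ∈ distTriang T) (x : F.obj (op D.obj₂))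
    (hx : pull F D.mor₁ x = 0) : ∃ y : F.obj (op D.obj₃), pull F D.mor₂ y = x :=
  (ShortComplex.moduleCat_exact_iff _).1 (F.map_distinguished_op_exact D hD) x hx

/-- Exactness of `F(X[1]) → F(Z) → F(Y)` for a distinguished triangle `X ⟶ Y ⟶ Z ⟶ X[1]`. -/
lemma exists_pull_mor₃_eq (D : Triangle T) (hD : D ∈ distTriang T) (y : F.obj (op D.obj₃))
    (hy : pull F D.mor₂ y = 0) : ∃ z : F.obj (op (D.obj₁⟦(1 : ℤ)⟧)), pull F D.mor₃ z = y :=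
  exists_pull_mor₂_eq F D.rotate (rot_of_distTriang D hD) y hy

variable {F}

/-- Five lemma for the natural transformation given by an element. -/
lemma bijective_yonedaEval_obj₂ {Y : T} (y : F.obj (op Y)) (D : Triangle T)
    (hD : D ∈ distTriang T)
    (h₀ : Function.Injective (yonedaEval F y (D.obj₃⟦(-1 : ℤ)⟧)))
    (h₁ : Function.Bijective (yonedaEval F y D.obj₁))
    (h₃ : Function.Bijective (yonedaEval F y D.obj₃))
    (h₄ : Function.Surjective (yonedaEval F y (D.obj₁⟦(1 : ℤ)⟧))) :
    Function.Bijective (yonedaEval F y D.obj₂) := by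
  have hF₁₂ (t : F.obj (op D.obj₃)) : pull F D.mor₁ (pull F D.mor₂ t) = 0 := by
    rw [← pull_comp, comp_distTriang_mor_zero₁₂ _ hD, pull_zero]
  refine ⟨(injective_iff_map_eq_zero _).2 fun f hf => ?_, fun t => ?_⟩
  · obtain ⟨g, rfl⟩ := Triangle.yoneda_exact₂ D hD f <| (injective_iff_map_eq_zero _).1 h₁.1 _ <| by
      rw [yonedaEval_apply, pull_comp]
      exact (congrArg _ hf).trans (map_zero _)
    obtain ⟨z, hz⟩ := exists_pull_mor₃_eq F D hD (pull F g y) (by rw [← pull_comp]; exact hf)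
    obtain ⟨k, rfl⟩ := h₄ z
    have : g = D.mor₃ ≫ k := h₃.1 (by simpa [pull_comp] using hz.symm)
    rw [this, reassoc_of% comp_distTriang_mor_zero₂₃ _ hD, zero_comp]
  · obtain ⟨f₁, hf₁⟩ := h₁.2 (pull F D.mor₁ t)
    rw [yonedaEval_apply] at hf₁
    obtain ⟨w, hw, hext⟩ : ∃ w : D.obj₃⟦(-1 : ℤ)⟧ ⟶ D.obj₁, w ≫ D.mor₁ = 0 ∧
        ∀ f : D.obj₁ ⟶ Y, w ≫ f = 0 → ∃ g : D.obj₂ ⟶ Y, f = D.mor₁ ≫ g :=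
      ⟨D.invRotate.mor₁, comp_distTriang_mor_zero₁₂ _ (inv_rot_of_distTriang _ hD),
        Triangle.yoneda_exact₂ _ (inv_rot_of_distTriang _ hD)⟩
    obtain ⟨f₂, rfl⟩ := hext f₁ <| (injective_iff_map_eq_zero _).1 h₀ _ <| by
      rw [yonedaEval_apply, pull_comp, hf₁, ← pull_comp, hw, pull_zero]
    obtain ⟨s, hs⟩ := exists_pull_mor₂_eq F D hD (t - pull F f₂ y) (by
      rw [map_sub, sub_eq_zero, ← pull_comp, hf₁])
    obtain ⟨f₃, rfl⟩ := h₃.2 s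
    refine ⟨f₂ + D.mor₂ ≫ f₃, ?_⟩
    rw [yonedaEval_apply] at hs ⊢
    rw [pull_add, pull_comp, hs]
    abel

end Homological

instance {R : Type v} [Ring R] {T : Type*} [Category.{w} T] [Preadditive T] [Linear R T]
    [HasZeroObject T] [HasShift T ℤ] [∀ n : ℤ, (shiftFunctor T n).Additive] [Pretriangulated T]
    (X : T) : ((linearYoneda R T).obj X).IsHomological where
  exact D hD := by
    rw [ShortComplex.moduleCat_exact_iff]
    intro (x : D.obj₂.unop ⟶ X) (hx : D.mor₂.unop ≫ x = 0)
    obtain ⟨y, hy⟩ := Pretriangulated.Triangle.yoneda_exact₂ _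
      (Pretriangulated.unop_distinguished D hD) x hx
    exact ⟨y, hy.symm⟩

/-! ### Detecting isomorphisms on the generator -/

section Detect

variable {A : Type u} [Ring A] [HasDerivedCategory.{w} (ModuleCat.{u} A)]

/-- A distinguished triangle of the derived category whose objects are perfect is a distinguished
triangle of perfect complexes. -/
lemma exists_perf_distTriang {X Y Z : DerivedCategory (ModuleCat.{u} A)} (f : X ⟶ Y) (g : Y ⟶ Z)
    (k : Z ⟶ X⟦(1 : ℤ)⟧)
    (hD : Pretriangulated.Triangle.mk f g k ∈ distTriang (DerivedCategory (ModuleCat.{u} A)))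
    (hX : isPerfect A X) (hY : isPerfect A Y) (hZ : isPerfect A Z) :
    ∃ k' : (⟨Z, hZ⟩ : Perf A) ⟶ (⟨X, hX⟩ : Perf A)⟦(1 : ℤ)⟧,
      Pretriangulated.Triangle.mk (ObjectProperty.homMk f : (⟨X, hX⟩ : Perf A) ⟶ ⟨Y, hY⟩)
        (ObjectProperty.homMk g : (⟨Y, hY⟩ : Perf A) ⟶ ⟨Z, hZ⟩) k' ∈ distTriang (Perf A) := by
  refine ⟨ObjectProperty.homMk (k ≫ ((isPerfect A).ι.commShiftIso (1 : ℤ)).inv.app ⟨X, hX⟩),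
    Pretriangulated.isomorphic_distinguished _ hD _ <|
      Pretriangulated.Triangle.isoMk _ _ (Iso.refl X) (Iso.refl Y) (Iso.refl Z)
        ((Category.comp_id _).trans (Category.id_comp _).symm)
        ((Category.comp_id _).trans (Category.id_comp _).symm) ?_⟩
  change ((k ≫ ((isPerfect A).ι.commShiftIso (1 : ℤ)).inv.app ⟨X, hX⟩) ≫
    ((isPerfect A).ι.commShiftIso (1 : ℤ)).hom.app ⟨X, hX⟩) ≫ (𝟙 X)⟦(1 : ℤ)⟧' = 𝟙 Z ≫ k
  have e := ((isPerfect A).ι.commShiftIso (1 : ℤ)).inv_hom_id_app ⟨X, hX⟩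
  exact (congrArg (_ ≫ ·) ((shiftFunctor _ (1 : ℤ)).map_id X)).trans <| (Category.comp_id _).trans <| (Category.assoc _ _ _).trans <|
    (congrArg (k ≫ ·) e).trans <| (Category.comp_id _).trans (Category.id_comp _).symm

variable {R : Type v} [Ring R] {F : (Perf A)ᵒᵖ ⥤ ModuleCat.{w} R} [F.IsHomological]

/-- The objects `Z` of the derived category which are perfect and such that
`Hom(-, Y) ⟶ F` is bijective on all the shifts of `Z`. -/
def bijectiveLocus {Y : Perf A} (y : F.obj (op Y)) :
    ObjectProperty (DerivedCategory (ModuleCat.{u} A)) :=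
  fun Z => ∃ h : isPerfect A Z, ∀ k : ℤ,
    Function.Bijective (yonedaEval F y ((⟨Z, h⟩ : Perf A)⟦k⟧))

instance {Y : Perf A} (y : F.obj (op Y)) : (bijectiveLocus y).IsStableUnderRetracts where
  of_retract := by
    rintro Z Z' r ⟨h', hk⟩
    have h : isPerfect A Z := (isPerfect A).prop_of_retract r h'
    let r' : Retract (⟨Z, h⟩ : Perf A) ⟨Z', h'⟩ :=
      { i := ObjectProperty.homMk r.i
        r := ObjectProperty.homMk r.r
        retract := ObjectProperty.hom_ext _ r.retract }
    exact ⟨h, fun k => bijective_yonedaEval_of_retract (r'.map (shiftFunctor _ k)) (hk k)⟩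

instance {Y : Perf A} (y : F.obj (op Y)) : (bijectiveLocus y).IsTriangulated where
  exists_zero := by
    obtain ⟨Z, hZ₀, h⟩ := (isPerfect A).exists_prop_of_containsZero
    refine ⟨Z, hZ₀, h, fun k => ?_⟩
    have hZ : IsZero (⟨Z, h⟩ : Perf A) :=
      (IsZero.iff_id_eq_zero _).2 (ObjectProperty.hom_ext _ (hZ₀.eq_of_src _ _))
    have hZ' := (shiftFunctor (Perf A) k).map_isZero hZ
    refine ⟨fun f g _ => hZ'.eq_of_src _ _, fun t => ⟨0, ?_⟩⟩
    have := pull_zero F (X := (⟨Z, h⟩ : Perf A)⟦k⟧) t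
    rw [hZ'.eq_of_src 0 (𝟙 _), pull_id] at this
    rw [this, map_zero]
  isStableUnderShiftBy n :=
    { le_shift := by
        rintro Z ⟨h, hk⟩
        exact ⟨(isPerfect A).le_shift n _ h, fun k => bijective_yonedaEval_of_iso
          ((shiftFunctorAdd (Perf A) n k).app ⟨Z, h⟩ ≪≫ (shiftFunctor (Perf A) k).mapIso
            (ObjectProperty.isoMk _ (((isPerfect A).ι.commShiftIso n).app ⟨Z, h⟩)))
          (hk (n + k))⟩ }
  toIsTriangulatedClosed₂ := .mk' <| by
    rintro D hD ⟨h₁, hk₁⟩ ⟨h₃, hk₃⟩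
    have h₂ : isPerfect A D.obj₂ := (isPerfect A).ext_of_isTriangulatedClosed₂ D hD h₁ h₃
    refine ⟨h₂, fun k => ?_⟩
    obtain ⟨k', hD'⟩ := exists_perf_distTriang D.mor₁ D.mor₂ D.mor₃ hD h₁ h₂ h₃
    exact bijective_yonedaEval_obj₂ y _ (Pretriangulated.Triangle.shift_distinguished _ hD' k)
      (bijective_yonedaEval_of_iso ((shiftFunctorAdd (Perf A) k (-1)).app ⟨_, h₃⟩) (hk₃ _)).1
      (hk₁ k) (hk₃ k)
      (bijective_yonedaEval_of_iso ((shiftFunctorAdd (Perf A) k 1).app ⟨_, h₁⟩) (hk₁ _)).2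

/-- A natural transformation from a representable functor to a homological functor is an
isomorphism if it is bijective on all the shifts of the generator `A`. -/
lemma bijective_yonedaEval_of_regularPerf {Y : Perf A} (y : F.obj (op Y))
    (h : ∀ n : ℤ, Function.Bijective (yonedaEval F y ((regularPerf A)⟦n⟧))) (Z : Perf A) :
    Function.Bijective (yonedaEval F y Z) := by
  have : isPerfect A ≤ bijectiveLocus y := by
    refine (ObjectProperty.triangEnvelope_le_iff _).2 fun Z hZ => ?_
    obtain rfl : regularObj A = Z := by simpa using hZ
    exact ⟨(regularPerf A).property, h⟩
  obtain ⟨_, hk⟩ := this _ Z.property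
  exact bijective_yonedaEval_of_iso ((shiftFunctorZero (Perf A) ℤ).app Z) (hk 0)

end Detect

/-! ### Modules as perfect complexes -/

section Stalk

variable (A : Type u) [Ring A] [HasDerivedCategory.{w} (ModuleCat.{u} A)]

/-- The category of the modules which are perfect when seen as complexes in degree `0`. -/
abbrev PerfMod :=
  ((isPerfect A).inverseImage
    (DerivedCategory.singleFunctor (ModuleCat.{u} A) 0)).FullSubcategory

/-- The free module of rank one. -/
noncomputable abbrev regularMod : PerfMod A := ⟨ModuleCat.of A A, (regularPerf A).property⟩

variable {A}

/-- The inclusion of modules into perfect complexes, in degree `0`. -/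
noncomputable def perfSingle : PerfMod A ⥤ Perf A :=
  (isPerfect A).lift (ObjectProperty.ι _ ⋙ DerivedCategory.singleFunctor (ModuleCat.{u} A) 0)
    (fun N => N.property)

instance : (perfSingle (A := A)).Full where
  map_surjective f :=
    ⟨ObjectProperty.homMk ((DerivedCategory.singleFunctor (ModuleCat.{u} A) 0).preimage f.hom),
      ObjectProperty.hom_ext _
        ((DerivedCategory.singleFunctor (ModuleCat.{u} A) 0).map_preimage f.hom)⟩

instance : (perfSingle (A := A)).Faithful where
  map_injective h := ObjectProperty.hom_ext _ <|
    (DerivedCategory.singleFunctor (ModuleCat.{u} A) 0).map_injective (congrArg (·.hom) h)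

instance : (perfSingle (A := A)).Additive where
  map_add {_ _ _ _} := ObjectProperty.hom_ext _
    (DerivedCategory.singleFunctor (ModuleCat.{u} A) 0).map_add

/-- The perfect complex `N[-n]`, for a module `N` which is perfect. -/
noncomputable def stalk (n : ℤ) : PerfMod A ⥤ Perf A := perfSingle ⋙ shiftFunctor (Perf A) (-n)

instance (n : ℤ) : (stalk (A := A) n).Full := by unfold stalk; infer_instance
instance (n : ℤ) : (stalk (A := A) n).Faithful := by unfold stalk; infer_instance
instance (n : ℤ) : (stalk (A := A) n).Additive := by unfold stalk; infer_instance

/-- `N[-n][1] = N[-(n-1)]`. -/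
noncomputable def stalkShiftIso (n n' : ℤ) (h : n' + 1 = n) :
    stalk (A := A) n ⋙ shiftFunctor (Perf A) (1 : ℤ) ≅ stalk n' :=
  Functor.associator _ _ _ ≪≫ Functor.isoWhiskerLeft _
    (shiftFunctorAdd' (Perf A) (-n) 1 (-n') (by lia)).symm

/-- The underlying complex of `N[-n]`. -/
noncomputable def ιStalkIso (n : ℤ) (N : PerfMod A) :
    ((stalk n).obj N).obj ≅ (DerivedCategory.singleFunctor (ModuleCat.{u} A) n).obj N.obj :=
  ((isPerfect A).ι.commShiftIso (-n)).app _ ≪≫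
    ((DerivedCategory.singleFunctors (ModuleCat.{u} A)).shiftIso (-n) n 0 (by lia)).app N.obj

/-- For `n < m` this is the vanishing of negative extensions, and for `n > m` it holds because `A`
is projective. -/
lemma from_stalk_regularMod_eq_zero {n m : ℤ} (h : n ≠ m) {N : PerfMod A}
    (f : (stalk n).obj (regularMod A) ⟶ (stalk m).obj N) : f = 0 := by
  have key (g : (DerivedCategory.singleFunctor (ModuleCat.{u} A) n).obj (ModuleCat.of A A) ⟶
      (DerivedCategory.singleFunctor (ModuleCat.{u} A) m).obj N.obj) : g = 0 := by
    rcases lt_or_gt_of_ne h with h | h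
    · exact DerivedCategory.TStructure.t.zero g n m h
    · have : Projective (ModuleCat.of A A) := inferInstance
      exact DerivedCategory.from_singleFunctor_obj_eq_zero_of_projective
        (L := (CochainComplex.singleFunctor (ModuleCat.{u} A) m).obj N.obj) g m h
  apply ObjectProperty.hom_ext
  rw [← cancel_epi (ιStalkIso n (regularMod A)).inv, ← cancel_mono (ιStalkIso m N).hom]
  exact (key _).trans (key _).symm

lemma from_stalk_regularMod_shift_eq_zero {n m : ℤ} (h : n + 1 ≠ m) {N : PerfMod A}
    (f : (stalk n).obj (regularMod A) ⟶ ((stalk m).obj N)⟦(1 : ℤ)⟧) : f = 0 := by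
  rw [← cancel_mono ((stalkShiftIso m (m - 1) (by lia)).app N).hom, zero_comp]
  exact from_stalk_regularMod_eq_zero (by lia) _

/-- The morphism in `PerfMod A` given by a linear map. -/
noncomputable def ofLin {N N' : PerfMod A} (l : N.obj →ₗ[A] N'.obj) : N ⟶ N' :=
  ObjectProperty.homMk (ModuleCat.ofHom l)

lemma ofLin_comp {N N' N'' : PerfMod A} (l : N.obj →ₗ[A] N'.obj) (l' : N'.obj →ₗ[A] N''.obj) :
    ofLin l ≫ ofLin l' = ofLin (l' ∘ₗ l) := rfl

lemma ofLin_add {N N' : PerfMod A} (l l' : N.obj →ₗ[A] N'.obj) :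
    ofLin (l + l') = ofLin l + ofLin l' := rfl

lemma ofLin_sum {N N' : PerfMod A} {ι : Type*} (s : Finset ι) (l : ι → N.obj →ₗ[A] N'.obj) :
    ofLin (∑ i ∈ s, l i) = ∑ i ∈ s, ofLin (l i) :=
  map_sum (AddMonoidHom.mk' ofLin ofLin_add) l s

/-- The morphism `A ⟶ N` sending `1` to `x`. -/
noncomputable def elemHom (N : PerfMod A) (x : N.obj) : regularMod A ⟶ N :=
  ofLin (LinearMap.toSpanSingleton A N.obj x)

lemma elemHom_comp_ofLin {N N' : PerfMod A} (x : N.obj) (l : N.obj →ₗ[A] N'.obj) :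
    elemHom N x ≫ ofLin l = elemHom N' (l x) := by
  rw [elemHom, elemHom, ofLin_comp, LinearMap.comp_toSpanSingleton]

lemma elemHom_add (N : PerfMod A) (x y : N.obj) :
    elemHom N (x + y) = elemHom N x + elemHom N y := by
  rw [elemHom, LinearMap.toSpanSingleton_add, ofLin_add]
  rfl

lemma elemHom_smul (N : PerfMod A) (a : A) (x : N.obj) :
    elemHom N (a • x) = elemHom (regularMod A) a ≫ elemHom N x :=
  (elemHom_comp_ofLin (N := regularMod A) a (LinearMap.toSpanSingleton A N.obj x)).symm

lemma elemHom_bijective (N : PerfMod A) : Function.Bijective (elemHom N) := by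
  refine ⟨fun x y h => ?_, fun f => ⟨f.hom.hom (1 : A), ?_⟩⟩
  · have h' : (1 : A) • x = (1 : A) • y := congrArg (fun f => f.hom.hom (1 : A)) h
    simpa only [one_smul] using h'
  · exact ObjectProperty.hom_ext _ <| ModuleCat.hom_ext <| LinearMap.ext_ring <| one_smul A _

/-- Every morphism `A[-n] ⟶ N[-n]` is given by an element of `N`. -/
lemma stalk_map_elemHom_bijective (n : ℤ) (N : PerfMod A) :
    Function.Bijective fun x : N.obj => (stalk n).map (elemHom N x) :=
  (Functor.FullyFaithful.ofFullyFaithful (stalk n)).map_bijective _ _ |>.comp (elemHom_bijective N)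

end Stalk

/-! ### Short exact sequences and free modules -/

lemma exists_shift_distTriang {T : Type*} [Category* T] [Preadditive T] [HasZeroObject T]
    [HasShift T ℤ] [∀ n : ℤ, (shiftFunctor T n).Additive] [Pretriangulated T]
    {X Y Z : T} (f : X ⟶ Y) (g : Y ⟶ Z) (k : Z ⟶ X⟦(1 : ℤ)⟧)
    (h : Pretriangulated.Triangle.mk f g k ∈ distTriang T) (n : ℤ) :
    ∃ δ : Z⟦n⟧ ⟶ X⟦n⟧⟦(1 : ℤ)⟧,
      Pretriangulated.Triangle.mk (f⟦n⟧') (g⟦n⟧') δ ∈ distTriang T := by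
  have hD := Pretriangulated.Triangle.shift_distinguished _ h n
  dsimp [Pretriangulated.Triangle.shiftFunctor] at hD
  -- the shift of a triangle introduces the same sign in its three morphisms
  obtain hn | hn := Int.units_eq_one_or n.negOnePow
  · rw [hn] at hD
    simp only [one_smul] at hD
    exact ⟨_, hD⟩
  · rw [hn] at hD
    simp only [Units.neg_smul, one_smul] at hD
    refine ⟨_, Pretriangulated.isomorphic_distinguished _ hD _ <|
      Pretriangulated.Triangle.isoMk _ _ (Iso.refl _) (-Iso.refl _) (Iso.refl _)
        ((Preadditive.comp_neg _ _).trans <| (congrArg Neg.neg (Category.comp_id _)).trans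
          (Category.id_comp _).symm)
        ((Category.comp_id _).trans <| ((Preadditive.neg_comp_neg _ _).trans
          (Category.id_comp _)).symm)
        ((congrArg (_ ≫ ·) ((shiftFunctor T (1 : ℤ)).map_id _)).trans <|
          (Category.comp_id _).trans (Category.id_comp _).symm)⟩

section ShortExact

variable {A : Type u} [Ring A] [HasDerivedCategory.{w} (ModuleCat.{u} A)]

/-- A short exact sequence of modules `0 → N₁ → N₂ → N₃ → 0` gives a distinguished triangle
`N₁[-n] ⟶ N₂[-n] ⟶ N₃[-n] ⟶ N₁[-n][1]`. -/
lemma exists_stalk_distTriang {N₁ N₂ N₃ : PerfMod A} {f : N₁.obj →ₗ[A] N₂.obj}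
    {g : N₂.obj →ₗ[A] N₃.obj} (hf : Function.Injective f) (hfg : Function.Exact f g)
    (hg : Function.Surjective g) (n : ℤ) :
    ∃ δ : (stalk n).obj N₃ ⟶ ((stalk n).obj N₁)⟦(1 : ℤ)⟧,
      Pretriangulated.Triangle.mk ((stalk n).map (ofLin f)) ((stalk n).map (ofLin g)) δ ∈
        distTriang (Perf A) := by
  have hS := ModuleCat.shortComplex_shortExact
    (ModuleCat.shortComplexOfCompEqZero _ _ hfg.linearMap_comp_eq_zero) hfg hf hg
  obtain ⟨k, hk⟩ := exists_perf_distTriang _ _ _ hS.singleTriangle_distinguished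
    N₁.property N₂.property N₃.property
  exact exists_shift_distTriang (perfSingle.map (ofLin f)) (perfSingle.map (ofLin g)) k hk (-n)

lemma isPerfect_X₂ {S : ShortComplex (ModuleCat.{u} A)} (hS : S.ShortExact)
    (h₁ : isPerfect A ((DerivedCategory.singleFunctor _ 0).obj S.X₁))
    (h₃ : isPerfect A ((DerivedCategory.singleFunctor _ 0).obj S.X₃)) :
    isPerfect A ((DerivedCategory.singleFunctor _ 0).obj S.X₂) :=
  (isPerfect A).ext_of_isTriangulatedClosed₂ _ hS.singleTriangle_distinguished h₁ h₃

lemma isPerfect_X₃ {S : ShortComplex (ModuleCat.{u} A)} (hS : S.ShortExact)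
    (h₁ : isPerfect A ((DerivedCategory.singleFunctor _ 0).obj S.X₁))
    (h₂ : isPerfect A ((DerivedCategory.singleFunctor _ 0).obj S.X₂)) :
    isPerfect A ((DerivedCategory.singleFunctor _ 0).obj S.X₃) :=
  (isPerfect A).ext_of_isTriangulatedClosed₃ _ hS.singleTriangle_distinguished h₁ h₂

end ShortExact

section Free

variable (A : Type u) [Ring A] [HasDerivedCategory.{w} (ModuleCat.{u} A)]

lemma isPerfect_free (r : ℕ) : isPerfect A
    ((DerivedCategory.singleFunctor _ 0).obj (ModuleCat.of A (Fin r → A))) := by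
  induction r with
  | zero =>
    exact (isPerfect A).prop_of_isZero
      ((DerivedCategory.singleFunctor _ 0).map_isZero (ModuleCat.isZero_of_subsingleton _))
  | succ r hr =>
    have h0 : Function.Exact (LinearMap.single A (fun _ : Fin (r + 1) => A) 0)
        (LinearMap.funLeft A A (Fin.succ : Fin r → Fin (r + 1))) := by
      intro x
      constructor
      · intro hx
        refine ⟨x 0, funext fun i => ?_⟩
        refine Fin.cases ?_ (fun j => ?_) i
        · simp
        · simpa using (congrFun hx j).symm
      · rintro ⟨a, rfl⟩
        ext j
        simp [LinearMap.funLeft]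
    exact isPerfect_X₂ (ModuleCat.shortComplex_shortExact
      (ModuleCat.shortComplexOfCompEqZero _ _ h0.linearMap_comp_eq_zero) h0
      (Pi.single_injective (M := fun _ : Fin (r + 1) => A) 0)
      (LinearMap.funLeft_surjective_of_injective A A _ (Fin.succ_injective r)))
      (regularPerf A).property hr

/-- The free module of rank `r`. -/
noncomputable abbrev freeMod (r : ℕ) : PerfMod A :=
  ⟨ModuleCat.of A (Fin r → A), isPerfect_free A r⟩

variable {A}

lemma sum_proj_comp_elemHom (r : ℕ) :
    ∑ i : Fin r, ofLin (N := freeMod A r) (N' := regularMod A) (LinearMap.proj i) ≫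
      elemHom (freeMod A r) (Pi.single i 1) = 𝟙 (freeMod A r) := by
  have key : ∑ i : Fin r, LinearMap.toSpanSingleton A (Fin r → A) (Pi.single i 1) ∘ₗ
      LinearMap.proj i = LinearMap.id := by
    ext i j
    simp [Pi.single_apply, ite_apply]
  exact (ofLin_sum (N := freeMod A r) (N' := freeMod A r) _ _).symm.trans (congrArg ofLin key)

variable {R : Type v} [CommRing R] (F : (Perf A)ᵒᵖ ⥤ ModuleCat.{w} R) [F.Additive]

/-- An `A`-linear map `A^r → F(A[-n])` is given by an element of `F(A^r[-n])`. -/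
lemma exists_pull_elemHom_freeMod {n : ℤ} {r : ℕ} (q : (Fin r → A) →ₗ[A] gradedPart F n) :
    ∃ t : F.obj (op ((stalk n).obj (freeMod A r))), ∀ v : Fin r → A,
      pull F ((stalk n).map (elemHom (freeMod A r) v)) t = q v := by
  refine ⟨∑ i, pull F ((stalk n).map
    (ofLin (N := freeMod A r) (N' := regularMod A) (LinearMap.proj i))) (q (Pi.single i 1)),
    fun v => ?_⟩
  have hv : v = ∑ i, v i • (Pi.single i 1 : Fin r → A) := by
    ext j
    simp [Pi.single_apply]
  have hqv : q v = ∑ i, v i • q (Pi.single i 1) := by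
    conv_lhs => rw [hv]
    simp only [map_sum, map_smul]
  rw [map_sum]
  refine (Finset.sum_congr rfl fun i _ => ?_).trans hqv.symm
  exact (pull_comp F _ _ _).symm.trans <| congrArg (fun f => pull F f (q (Pi.single i 1))) <|
    ((stalk n).map_comp _ _).symm.trans <| congrArg _ <|
      elemHom_comp_ofLin (N := freeMod A r) (N' := regularMod A) v (LinearMap.proj i)

/-- An element of `F(A^r[-n])` is zero if its restrictions along all the morphisms
`A[-n] ⟶ A^r[-n]` are zero. -/
lemma freeMod_ext {n : ℤ} {r : ℕ} {t : F.obj (op ((stalk n).obj (freeMod A r)))}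
    (h : ∀ v : Fin r → A, pull F ((stalk n).map (elemHom (freeMod A r) v)) t = 0) : t = 0 := by
  rw [← pull_id F t, ← CategoryTheory.Functor.map_id, ← sum_proj_comp_elemHom, Functor.map_sum]
  refine (map_sum (yonedaEval F t _) _ _).trans (Finset.sum_eq_zero fun i _ => ?_)
  rw [yonedaEval_apply, Functor.map_comp, pull_comp, h, map_zero]

end Free

/-! ### Cohomological functors on finitely generated modules -/

section Regular

variable {A : Type u} [Ring A] [IsNoetherianRing A] [HasDerivedCategory.{w} (ModuleCat.{u} A)]

/-- Over a regular noetherian ring, the finitely generated modules are perfect. -/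
lemma isPerfect_of_finite (hA : IsRegularAlgebra A) (N : ModuleCat.{u} A) [Module.Finite A N] :
    isPerfect A ((DerivedCategory.singleFunctor _ 0).obj N) := by
  obtain ⟨d, hd⟩ := hA N inferInstance
  induction d generalizing N with
  | zero =>
    obtain ⟨r, π, hπ⟩ := Module.Finite.exists_fin' A N
    have : Projective N := (projective_iff_hasProjectiveDimensionLE_zero N).2 hd
    have : Epi (ModuleCat.ofHom π) := (ModuleCat.epi_iff_surjective _).2 hπ
    let ρ : Retract N (ModuleCat.of A (Fin r → A)) :=
      { i := Projective.factorThru (𝟙 N) (ModuleCat.ofHom π)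
        r := ModuleCat.ofHom π
        retract := Projective.factorThru_comp _ _ }
    exact (isPerfect A).prop_of_retract (ρ.map _) (isPerfect_free A r)
  | succ d ih =>
    obtain ⟨r, π, hπ⟩ := Module.Finite.exists_fin' A N
    have hS := LinearMap.shortExact_shortComplexKer hπ
    have : Projective (ModuleCat.of A (Fin r → A)) := inferInstance
    exact isPerfect_X₃ hS
      (ih (ModuleCat.of A (LinearMap.ker π)) ((hS.hasProjectiveDimensionLT_X₃_iff d this).1 hd))
      (isPerfect_free A r)

variable {R : Type v} [CommRing R] {F : (Perf A)ᵒᵖ ⥤ ModuleCat.{w} R} [F.IsHomological]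

omit [IsNoetherianRing A] in
lemma freeMod_eq_zero {n : ℤ} (h : ∀ x : gradedPart F n, x = 0) {r : ℕ}
    (t : F.obj (op ((stalk n).obj (freeMod A r)))) : t = 0 :=
  freeMod_ext F fun _ => h _

/-- If `F` vanishes on `A[-n]` for all `n < a`, then `F` vanishes on `N[-n]` for all `n < a` and
all the finitely generated modules `N`: a finite projective resolution of `N`, placed so that `N`
is in degree `n`, has its terms in the degrees `≤ n`. -/
lemma stalk_eq_zero (hA : IsRegularAlgebra A) {a : ℤ}
    (h : ∀ n < a, ∀ x : gradedPart F n, x = 0) {n : ℤ} (hn : n < a) (N : PerfMod A)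
    [Module.Finite A N.obj] (x : F.obj (op ((stalk n).obj N))) : x = 0 := by
  obtain ⟨d, hd⟩ := hA N.obj ‹_›
  induction d generalizing N n with
  | zero =>
    obtain ⟨r, π, hπ⟩ := Module.Finite.exists_fin' A N.obj
    have := (projective_iff_hasProjectiveDimensionLE_zero N.obj).2 hd
    rw [← IsProjective.iff_projective] at this
    obtain ⟨i, hi⟩ := Module.projective_lifting_property π LinearMap.id hπ
    have hip : ofLin i ≫ ofLin (N := freeMod A r) π = 𝟙 N := congrArg ofLin hi
    rw [← pull_id F x, ← CategoryTheory.Functor.map_id, ← hip, Functor.map_comp, pull_comp,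
      freeMod_eq_zero (h n hn) (pull F _ x), map_zero]
  | succ d ih =>
    obtain ⟨r, π, hπ⟩ := Module.Finite.exists_fin' A N.obj
    have hS := LinearMap.shortExact_shortComplexKer hπ
    have : Projective (ModuleCat.of A (Fin r → A)) := inferInstance
    let K : PerfMod A := ⟨ModuleCat.of A (LinearMap.ker π), isPerfect_of_finite hA _⟩
    obtain ⟨δ, hδ⟩ := exists_stalk_distTriang (N₁ := K) (N₂ := freeMod A r)
      (LinearMap.ker π).injective_subtype π.exact_subtype_ker_map hπ n
    obtain ⟨z, rfl⟩ := exists_pull_mor₃_eq F _ hδ x (freeMod_eq_zero (h n hn) _)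
    have hz : z = 0 :=
      eq_zero_of_iso F ((stalkShiftIso n (n - 1) (by lia)).symm.app K)
        (fun y => ih (n := n - 1) (by lia) K y
          ((hS.hasProjectiveDimensionLT_X₃_iff d this).1 hd)) z
    rw [hz]
    exact map_zero _

/-- If `F` vanishes in the degrees `< a`, then `F(N[-a])` identifies, for `N` finitely generated,
with the group of the `A`-linear maps `N → F(A[-a])`. The identity of `F(A[-a])` thus corresponds
to an element of `F(N[-a])`, where `N` is isomorphic to `F(A[-a])`: it is a quotient of some `A^r`,
because `F(A[-a])` itself may live in another universe. -/
lemma exists_stalk_bijective (hA : IsRegularAlgebra A) {a : ℤ}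
    (h : ∀ n < a, ∀ x : gradedPart F n, x = 0) [Module.Finite A (gradedPart F a)] :
    ∃ (N : PerfMod A) (_ : Module.Finite A N.obj) (t : F.obj (op ((stalk a).obj N))),
      Function.Bijective (yonedaEval F t ((stalk a).obj (regularMod A))) := by
  obtain ⟨r, q, hq⟩ := Module.Finite.exists_fin' A (gradedPart F a)
  obtain ⟨e, he⟩ := exists_pull_elemHom_freeMod F q
  let K := LinearMap.ker q
  let K' : PerfMod A := ⟨ModuleCat.of A K, isPerfect_of_finite hA _⟩
  let N : PerfMod A := ⟨ModuleCat.of A ((Fin r → A) ⧸ K), isPerfect_of_finite hA _⟩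
  obtain ⟨δ, hδ⟩ := exists_stalk_distTriang (N₁ := K') (N₂ := freeMod A r) (N₃ := N)
    K.injective_subtype (LinearMap.exact_subtype_mkQ K) K.mkQ_surjective a
  obtain ⟨t, ht⟩ : ∃ t : F.obj (op ((stalk a).obj N)),
      pull F ((stalk a).map (ofLin (N := freeMod A r) K.mkQ)) t = e := by
    refine exists_pull_mor₂_eq F _ hδ e ?_
    -- it suffices to check that the restriction to `K` vanishes after pulling back along
    -- a surjection from a free module
    obtain ⟨s, π, hπ⟩ := Module.Finite.exists_fin' A K
    let L : PerfMod A := ⟨ModuleCat.of A (LinearMap.ker π), isPerfect_of_finite hA _⟩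
    obtain ⟨δ', hδ'⟩ := exists_stalk_distTriang (N₁ := L) (N₂ := freeMod A s) (N₃ := K')
      (LinearMap.ker π).injective_subtype π.exact_subtype_ker_map hπ a
    obtain ⟨z, hz⟩ := exists_pull_mor₃_eq F _ hδ'
        (pull F ((stalk a).map (ofLin (N := K') (N' := freeMod A r) K.subtype)) e) <|
      freeMod_ext F fun v => by
        change pull F _ (pull F ((stalk a).map (ofLin (N := freeMod A s) (N' := K') π))
          (pull F ((stalk a).map (ofLin (N := K') (N' := freeMod A r) K.subtype)) e)) = 0
        rw [← pull_comp, ← pull_comp, ← Functor.map_comp, ← Functor.map_comp, elemHom_comp_ofLin,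
          elemHom_comp_ofLin]
        exact (he _).trans (π v).2
    have hz0 : z = 0 := eq_zero_of_iso F ((stalkShiftIso a (a - 1) (by lia)).symm.app L)
      (stalk_eq_zero hA h (by lia) L) z
    exact hz.symm.trans ((congrArg _ hz0).trans (map_zero _))
  have key (v : Fin r → A) : pull F ((stalk a).map (elemHom N (K.mkQ v))) t = q v := by
    rw [← he, ← ht, ← pull_comp, ← Functor.map_comp, elemHom_comp_ofLin]
  refine ⟨N, inferInstance, t, (injective_iff_map_eq_zero _).2 fun f hf => ?_, fun y => ?_⟩
  · obtain ⟨x, rfl⟩ := (stalk_map_elemHom_bijective a N).2 f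
    obtain ⟨v, rfl⟩ := K.mkQ_surjective x
    have hv : v ∈ K := (key v).symm.trans hf
    have hx : K.mkQ v = 0 := by simpa using hv
    simp only [hx]
    rw [elemHom, LinearMap.toSpanSingleton_zero]
    exact (stalk a).map_zero _ _
  · obtain ⟨v, rfl⟩ := hq y
    exact ⟨_, key v⟩

end Regular

/-! ### Finiteness of the graded parts -/

section GradedFinite

variable {R : Type v} [CommRing R] {A : Type u} [Ring A]
  [HasDerivedCategory.{w} (ModuleCat.{u} A)]

/-- The maps `Hom(A[-n], X) → M(A[-n])` given by an element of `M(X)` are `A`-linear. -/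
noncomputable def gradedEval [Algebra R A] (M : (Perf A)ᵒᵖ ⥤ ModuleCat.{w} R) [M.Additive]
    {X : Perf A} (x : M.obj (op X)) (n : ℤ) :
    gradedPart ((linearYoneda R (Perf A)).obj X) n →ₗ[A] gradedPart M n where
  __ := yonedaEval M x ((stalk n).obj (regularMod A))
  map_smul' a f := pull_comp M ((stalk n).map (elemHom (regularMod A) a)) f x

variable (R) in
/-- The `A`-linear map `Hom(A[-n], X) → Hom(A[-n], Y)` given by a morphism `X ⟶ Y`. -/
noncomputable def gradedPostcomp [Algebra R A] {X Y : Perf A} (f : X ⟶ Y) (n : ℤ) :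
    gradedPart ((linearYoneda R (Perf A)).obj X) n →ₗ[A]
      gradedPart ((linearYoneda R (Perf A)).obj Y) n :=
  gradedEval ((linearYoneda R (Perf A)).obj Y) f n

variable (R) in
lemma finite_gradedPart_stalk [Algebra R A] (n : ℤ) (N : PerfMod A) [Module.Finite A N.obj] :
    Module.Finite A (gradedPart ((linearYoneda R (Perf A)).obj ((stalk n).obj N)) n) := by
  let l : N.obj →ₗ[A] gradedPart ((linearYoneda R (Perf A)).obj ((stalk n).obj N)) n :=
    { toFun := fun x => (stalk n).map (elemHom N x)
      map_add' := fun x y => by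
        rw [elemHom_add, Functor.map_add]
        rfl
      map_smul' := fun a x => by
        rw [elemHom_smul, Functor.map_comp]
        rfl }
  exact Module.Finite.of_surjective l (stalk_map_elemHom_bijective n N).2

variable (M : (Perf A)ᵒᵖ ⥤ ModuleCat.{w} R) [M.Additive] [Module.Finite A (gradedValue M)]

lemma finite_gradedPart (n : ℤ) : Module.Finite A (gradedPart M n) :=
  Module.Finite.of_surjective (DirectSum.component A ℤ (gradedPart M) n) fun x =>
    ⟨DirectSum.of _ n x, DirectSum.of_eq_same n x⟩

/-- The elements of a finite generating family of `M^*(A)` have finite support. -/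
lemma exists_bound : ∃ b : ℕ, ∀ n : ℤ, b < n.natAbs → ∀ x : gradedPart M n, x = 0 := by
  classical
  obtain ⟨r, q, hq⟩ := Module.Finite.exists_fin' A (gradedValue M)
  let S : Finset ℤ := Finset.univ.biUnion fun i : Fin r => DFinsupp.support (q (Pi.single i 1))
  refine ⟨S.sup Int.natAbs, fun n hn x => ?_⟩
  have hnS : n ∉ S := fun h => hn.not_ge (Finset.le_sup (f := Int.natAbs) h)
  have hl : DirectSum.component A ℤ (gradedPart M) n ∘ₗ q = 0 := by
    refine LinearMap.pi_ext' fun i => LinearMap.ext_ring ?_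
    by_contra h
    exact hnS (Finset.mem_biUnion.2 ⟨i, Finset.mem_univ i, DFinsupp.mem_support_iff.2 h⟩)
  obtain ⟨v, hv⟩ := hq (DirectSum.of _ n x)
  rw [← DirectSum.of_eq_same n x, ← hv]
  exact LinearMap.congr_fun hl v

end GradedFinite

/-! ### Approximation by perfect complexes -/

section Approx

variable {R : Type v} [CommRing R] {A : Type u} [Ring A]
  [HasDerivedCategory.{w} (ModuleCat.{u} A)]
  {M : (Perf A)ᵒᵖ ⥤ ModuleCat.{w} R} [M.IsHomological]

/-- The element `x ∈ M(X)` represents `M` in degrees `> m`: the map `Hom(A[-n], X) → M(A[-n])`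
is bijective for `n > m` and surjective for `n = m`. Moreover, the cohomology of `X` vanishes in
degrees `< m`. -/
structure IsApprox (m : ℤ) {X : Perf A} (x : M.obj (op X)) : Prop where
  bijective (n : ℤ) (hn : m < n) :
    Function.Bijective (yonedaEval M x ((stalk n).obj (regularMod A)))
  surjective : Function.Surjective (yonedaEval M x ((stalk m).obj (regularMod A)))
  eq_zero (n : ℤ) (hn : n < m) (f : (stalk n).obj (regularMod A) ⟶ X) : f = 0

/-- The cone of a morphism `f : P[-m] ⟶ X` which vanishes in `M` and covers the kernel of
`Hom(A[-m], X) → M(A[-m])` also represents `M` in degree `m`. Since `P[-m][1]` is in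
degree `m - 1`, the cohomology can only change in the degrees `m` and `m - 1`. -/
lemma IsApprox.exists_cone {m : ℤ} {X : Perf A} {x : M.obj (op X)} (h : IsApprox m x)
    {P : PerfMod A} (f : (stalk m).obj P ⟶ X) (hfx : pull M f x = 0)
    (hf : ∀ g : (stalk m).obj (regularMod A) ⟶ X, pull M g x = 0 → ∃ p, p ≫ f = g) :
    ∃ (X' : Perf A) (x' : M.obj (op X')) (i : X ⟶ X') (δ : X' ⟶ ((stalk m).obj P)⟦(1 : ℤ)⟧),
      Pretriangulated.Triangle.mk f i δ ∈ distTriang (Perf A) ∧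
      (∀ n, m ≤ n → Function.Bijective (yonedaEval M x' ((stalk n).obj (regularMod A)))) ∧
      ∀ n, n < m - 1 → ∀ g : (stalk n).obj (regularMod A) ⟶ X', g = 0 := by
  obtain ⟨X', i, δ, hD⟩ := Pretriangulated.distinguished_cocone_triangle f
  obtain ⟨x', hx'⟩ : ∃ x' : M.obj (op X'), pull M i x' = x := exists_pull_mor₂_eq M _ hD x hfx
  have hfi : f ≫ i = 0 := Pretriangulated.comp_distTriang_mor_zero₁₂ _ hD
  have lift {n : ℤ} (hn : n + 1 ≠ m) (g : (stalk n).obj (regularMod A) ⟶ X') :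
      ∃ g' : (stalk n).obj (regularMod A) ⟶ X, g = g' ≫ i :=
    Pretriangulated.Triangle.coyoneda_exact₃ _ hD g (from_stalk_regularMod_shift_eq_zero hn _)
  refine ⟨X', x', i, δ, hD, fun n hn => ⟨?_, fun t => ?_⟩, fun n hn g => ?_⟩
  · refine (injective_iff_map_eq_zero _).2 fun g hg => ?_
    obtain ⟨g, rfl⟩ := lift (by lia) g
    rw [yonedaEval_apply, pull_comp, hx'] at hg
    obtain rfl | hn := hn.eq_or_lt
    · obtain ⟨p, rfl⟩ := hf g hg
      rw [Category.assoc, hfi, comp_zero]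
    · rw [(injective_iff_map_eq_zero _).1 (h.bijective n hn).1 g hg, zero_comp]
  · obtain ⟨g, rfl⟩ : ∃ g, yonedaEval M x ((stalk n).obj (regularMod A)) g = t := by
      obtain rfl | hn := hn.eq_or_lt
      · exact h.surjective t
      · exact (h.bijective n hn).2 t
    exact ⟨g ≫ i, by rw [yonedaEval_apply, pull_comp, hx', yonedaEval_apply]⟩
  · obtain ⟨g, rfl⟩ := lift (by lia) g
    rw [h.eq_zero n (by lia) g, zero_comp]

variable [Algebra R A] [IsNoetherianRing A]

/-- An approximation of `M` can be improved by one degree. The finiteness which is needed in order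
to iterate is part of the statement. -/
lemma IsApprox.exists_pred [Module.Finite A (gradedValue M)] {m : ℤ} {X : Perf A}
    {x : M.obj (op X)} (h : IsApprox m x)
    [Module.Finite A (gradedPart ((linearYoneda R (Perf A)).obj X) m)] {m' : ℤ} (hm : m' + 1 = m) :
    ∃ (X' : Perf A) (x' : M.obj (op X')), IsApprox m' x' ∧
      Module.Finite A (gradedPart ((linearYoneda R (Perf A)).obj X') m') := by
  -- kill the kernel of `Hom(A[-m], X) → M(A[-m])`
  obtain ⟨r, q, hq⟩ := Module.Finite.exists_fin' A (LinearMap.ker (gradedEval M x m))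
  obtain ⟨f, hf⟩ := exists_pull_elemHom_freeMod ((linearYoneda R (Perf A)).obj X)
    (Submodule.subtype _ ∘ₗ q)
  change (stalk m).obj (freeMod A r) ⟶ X at f
  replace hf (v : Fin r → A) : (stalk m).map (elemHom (freeMod A r) v) ≫ f = (q v).1 := hf v
  have hfx : pull M f x = 0 := freeMod_ext M fun v => by
    rw [← pull_comp, hf]
    exact (q v).2
  obtain ⟨X₁, x₁, i, δ, hD, hbij, hzero⟩ := h.exists_cone f hfx fun g hg => by
    obtain ⟨v, hv⟩ := hq ⟨g, hg⟩
    exact ⟨_, (hf v).trans (congrArg Subtype.val hv)⟩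
  -- add a free module in degree `m' = m - 1` in order to obtain the surjectivity in this degree
  have := finite_gradedPart M m'
  obtain ⟨s, q', hq'⟩ := Module.Finite.exists_fin' A (gradedPart M m')
  obtain ⟨e, he⟩ := exists_pull_elemHom_freeMod M q'
  let Q := (stalk m').obj (freeMod A s)
  let y : M.obj (op (X₁ ⊞ Q)) := pull M biprod.fst x₁ + pull M biprod.snd e
  have hy {Z : Perf A} (g : Z ⟶ X₁ ⊞ Q) :
      pull M g y = pull M (g ≫ biprod.fst) x₁ + pull M (g ≫ biprod.snd) e := by
    simp only [y, map_add, pull_comp]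
    rfl
  refine ⟨X₁ ⊞ Q, y, ⟨fun n hn => ⟨?_, fun t => ?_⟩, fun t => ?_, fun n hn g => ?_⟩, ?_⟩
  · refine (injective_iff_map_eq_zero _).2 fun g hg => ?_
    have hsnd : g ≫ biprod.snd = 0 := from_stalk_regularMod_eq_zero hn.ne' _
    rw [yonedaEval_apply, hy, hsnd, pull_zero, add_zero] at hg
    have hfst := (injective_iff_map_eq_zero _).1 (hbij n (by lia)).1 _ hg
    exact biprod.hom_ext _ _ (by rw [hfst, zero_comp]) (by rw [hsnd, zero_comp])
  · obtain ⟨g, rfl⟩ := (hbij n (by lia)).2 t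
    exact ⟨biprod.lift g 0, by simp [hy, pull_zero]⟩
  · obtain ⟨v, rfl⟩ := hq' t
    refine ⟨biprod.lift 0 ((stalk m').map (elemHom (freeMod A s) v)), ?_⟩
    rw [yonedaEval_apply, hy, biprod.lift_fst, biprod.lift_snd, pull_zero, zero_add]
    exact he v
  · exact biprod.hom_ext _ _ ((hzero n (by lia) _).trans zero_comp.symm)
      ((from_stalk_regularMod_eq_zero (by lia) _).trans zero_comp.symm)
  -- the new cohomology in degree `m'` embeds into the sum of that of the two free modules
  · let e' := (stalkShiftIso m m' hm).app (freeMod A r)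
    have := finite_gradedPart_stalk R m' (freeMod A r)
    have := finite_gradedPart_stalk R m' (freeMod A s)
    refine Module.Finite.of_injective
      ((gradedPostcomp R (biprod.fst ≫ δ ≫ e'.hom) m').prod
        (gradedPostcomp R (biprod.snd : X₁ ⊞ Q ⟶ Q) m'))
      ((injective_iff_map_eq_zero _).2 fun (g : (stalk m').obj (regularMod A) ⟶ X₁ ⊞ Q) hg => ?_)
    obtain ⟨h₁, h₂⟩ := Prod.ext_iff.1 hg
    change g ≫ biprod.fst ≫ δ ≫ e'.hom = 0 at h₁
    change g ≫ biprod.snd = 0 at h₂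
    replace h₁ : (g ≫ biprod.fst) ≫ δ = 0 := by
      rw [← cancel_mono e'.hom]
      simpa using h₁
    obtain ⟨k, hk⟩ : ∃ k : _ ⟶ X, g ≫ biprod.fst = k ≫ i :=
      Pretriangulated.Triangle.coyoneda_exact₃ _ hD _ h₁
    rw [h.eq_zero m' (by lia) k, zero_comp] at hk
    exact biprod.hom_ext _ _ (hk.trans zero_comp.symm) (h₂.trans zero_comp.symm)

lemma exists_isApprox (M : (Perf A)ᵒᵖ ⥤ ModuleCat.{w} R) [M.IsHomological]
    [Module.Finite A (gradedValue M)] {b : ℤ} (hb : ∀ n ≥ b, ∀ x : gradedPart M n, x = 0) (k : ℕ) :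
    ∃ (X : Perf A) (x : M.obj (op X)), IsApprox (b - k) x ∧
      Module.Finite A (gradedPart ((linearYoneda R (Perf A)).obj X) (b - k)) := by
  induction k with
  | zero =>
    obtain ⟨O, hO⟩ := HasZeroObject.zero (C := Perf A)
    have hsurj {n : ℤ} (hn : b ≤ n) : Function.Surjective
        (yonedaEval M (0 : M.obj (op O)) ((stalk n).obj (regularMod A))) :=
      fun t => ⟨0, (map_zero _).trans (hb n hn t).symm⟩
    have : Subsingleton (gradedPart ((linearYoneda R (Perf A)).obj O) (b - (0 : ℕ))) :=
      ⟨fun f g => hO.eq_of_tgt f g⟩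
    exact ⟨O, 0, ⟨fun n hn => ⟨fun f g _ => hO.eq_of_tgt f g, hsurj (by lia)⟩, hsurj (by simp),
      fun n _ f => hO.eq_of_tgt _ _⟩, inferInstance⟩
  | succ k ih =>
    obtain ⟨X, x, hx, _⟩ := ih
    exact hx.exists_pred (by push_cast; ring)

end Approx

end PerfRep

theorem corollaryc {R : Type v} [CommRing R] {A : Type u} [Ring A] [Algebra R A]
    [IsNoetherianRing A] [HasDerivedCategory.{w} (ModuleCat.{u} A)]
    (hA : PerfRep.IsRegularAlgebra A)
    (M : (PerfRep.Perf A)ᵒᵖ ⥤ ModuleCat.{w} R)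
    (hlin : ∀ {X Y : PerfRep.Perf A} (f : X ⟶ Y) (r : R), M.map (r • f).op = r • M.map f.op)
    [M.IsHomological] (hfg : Module.Finite A (PerfRep.gradedValue M)) :
    ∃ X : PerfRep.Perf A, Nonempty (M ≅ (linearYoneda R (PerfRep.Perf A)).obj X) := by
  open PerfRep in
  obtain ⟨b, hb⟩ := exists_bound M
  -- `m = -(b + 1)` is below all the degrees in which `M` is nonzero
  obtain ⟨m, hm, X, x, hx, _⟩ : ∃ m : ℤ, m + 1 = -b ∧ ∃ (X : Perf A) (x : M.obj (op X)),
      IsApprox m x ∧ Module.Finite A (gradedPart ((linearYoneda R (Perf A)).obj X) m) :=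
    ⟨_, by push_cast; ring, exists_isApprox M (b := b + 1) (fun n hn => hb n (by lia)) (2 * b + 2)⟩
  have hM (n : ℤ) (hn : n < m + 1) : ∀ t : gradedPart M n, t = 0 := hb n (by lia)
  -- `Hom(A[-n], X)` and `M(A[-n])` only differ for `n = m`, where the latter is zero: the cone of
  -- the morphism `N[-m] ⟶ X` with `N = Hom(A[-m], X)` corrects this
  obtain ⟨N, _, t, ht⟩ := exists_stalk_bijective (F := (linearYoneda R (Perf A)).obj X) hA hx.eq_zero
  change (stalk m).obj N ⟶ X at t
  obtain ⟨X', x', i, δ, hD, hbij, hzero⟩ := hx.exists_cone t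
    (stalk_eq_zero hA hM (by lia) N _) (fun g _ => ht.2 g)
  -- in degree `m - 1`, the injectivity of `Hom(A[-m], N[-m]) → Hom(A[-m], X)` is used
  have hzero' (n : ℤ) (hn : n < m) (g : (stalk n).obj (regularMod A) ⟶ X') : g = 0 := by
    obtain hn | rfl : n < m - 1 ∨ n = m - 1 := by lia
    · exact hzero n hn g
    let e := (stalkShiftIso m (m - 1) (by lia)).app (regularMod A)
    obtain ⟨p, hp⟩ := (shiftFunctor (Perf A) (1 : ℤ)).map_surjective (e.hom ≫ g ≫ δ)
    have hp0 : p ≫ t = 0 := by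
      apply (shiftFunctor (Perf A) (1 : ℤ)).map_injective
      have : δ ≫ t⟦(1 : ℤ)⟧' = 0 := Pretriangulated.comp_distTriang_mor_zero₃₁ _ hD
      rw [Functor.map_comp, hp, Category.assoc, Category.assoc, this, comp_zero, comp_zero,
        Functor.map_zero]
    have hp0' : p = 0 := (injective_iff_map_eq_zero _).1 ht.1 p hp0
    rw [hp0', Functor.map_zero] at hp
    obtain ⟨k, rfl⟩ := Pretriangulated.Triangle.coyoneda_exact₃ _ hD g (by
      rw [← cancel_epi e.hom]
      exact hp.symm.trans comp_zero.symm)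
    rw [hx.eq_zero _ (by lia) k]
    exact zero_comp
  have hbij' (n : ℤ) : Function.Bijective (yonedaEval M x' ((stalk n).obj (regularMod A))) := by
    obtain hn | hn := le_or_gt m n
    · exact hbij n hn
    · exact ⟨fun f g _ => (hzero' n hn f).trans (hzero' n hn g).symm,
        fun s => ⟨0, (map_zero _).trans (hM n (by lia) s).symm⟩⟩
  refine ⟨X', nonempty_iso_linearYoneda M hlin x' (bijective_yonedaEval_of_regularPerf x' ?_)⟩
  intro n
  have h : Function.Bijective
    (yonedaEval M x' ((shiftFunctor (Perf A) (- -n)).obj (regularPerf A))) := hbij' (-n)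
  rwa [neg_neg] at h
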